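/- Let $\mathscr A$ be a $W^\star$-algebra, i.e. a (unital) $C^\star$-algebra which is isometrically isomorphic, as a Banach space, to the dual $X^*$ of a complex Banach space $X$. Let $\mathscr A_{sa}^*$ be the real Banach space (with the dual norm) of all self-adjoint functionals on $\mathscr A$, i.e. of all bounded linear functionals that take real values on self-adjoint elements. A functional on $\mathscr A\cong X^*$ is called normal if it is the evaluation at a point of the predual $X$. Let $\mathscr P\subset\mathscr A_{sa}^*$ be the set of normal positive linear functionals. For $\omega\in\mathscr P$ let $T_\omega\mathscr P\subset\mathscr A_{sa}^*$ be the tangent double cone of $\mathscr P$ at $\omega$: the set of all $\eta$ for which there exist $\epsilon>0$ and a $C^1$-curve $\gamma:(-\epsilon,\epsilon)\to\mathscr A_{sa}^*$ with $\gamma(t)\in\mathscr P$ for all $t$, $\gamma(0)=\omega$ and $\dot\gamma(0)=\eta$. Let $AC_\omega$ be the set of all $\eta\in\mathscr A_{sa}^*$ that are absolutely continuous with respect to $\omega$: for every $\epsilon>0$ there is $\delta>0$ such that $|\eta(\mathbf a)|<\epsilon$ for every positive $\mathbf a\in\mathscr A$ with $\|\mathbf a\|\le1$ and $\omega(\mathbf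 a)<\delta$. Then, for every $\omega\in\mathscr P$, the norm closure of the tangent double cone is $$\overline{T_\omega\mathscr P}=AC_\omega .$$ -/

import Mathlib

noncomputable section

/-- The tangent double cone of a subset `S` of a real normed space `B` at `ξ`: all velocities at
time `0` of `C¹` curves `γ : (-ε, ε) → B` that stay in `S` and pass through `ξ` at time `0`. -/
def tangentDoubleCone {B : Type*} [NormedAddCommGroup B] [NormedSpace ℝ B]
    (S : Set B) (ξ : B) : Set B :=
  {η | ∃ ε : ℝ, 0 < ε ∧ ∃ γ : ℝ → B,
    ContDiffOn ℝ 1 γ (Set.Ioo (-ε) ε) ∧ (∀ t ∈ Set.Ioo (-ε) ε, γ t ∈ S) ∧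
      γ 0 = ξ ∧ HasDerivAt γ η 0}

/-- The real Banach space of self-adjoint bounded linear functionals on a C⋆-algebra, i.e. of those
bounded (complex) linear functionals that are real on self-adjoint elements, with the dual norm. -/
def selfAdjointDual (A : Type*) [CStarAlgebra A] : Submodule ℝ (StrongDual ℂ A) where
  carrier := {φ | ∀ a : A, IsSelfAdjoint a → (φ a).im = 0}
  add_mem' := by
    intro φ ψ hφ hψ a ha
    simp [hφ a ha, hψ a ha]
  zero_mem' := by
    intro a _
    simp
  smul_mem' := by
    intro c φ hφ a ha
    simp [hφ a ha]

/-- Let the C⋆-algebra `A` be the Banach dual of `X` through the isometric isomorphism `e`. A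
functional on `A` is normal if it is the evaluation at a point of the predual `X`. -/
def IsNormalFunctional {A : Type*} [CStarAlgebra A]
    {X : Type*} [NormedAddCommGroup X] [NormedSpace ℂ X]
    (e : StrongDual ℂ X ≃ₗᵢ[ℂ] A) (φ : StrongDual ℂ A) : Prop :=
  ∃ x : X, ∀ a : A, φ a = e.symm a x

/-- The set of normal positive linear functionals on the W⋆-algebra `A` with predual `X`. The
positive elements of `A` are those of the form `star b * b`. -/
def normalPositiveFunctionals {A : Type*} [CStarAlgebra A]
    {X : Type*} [NormedAddCommGroup X] [NormedSpace ℂ X]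
    (e : StrongDual ℂ X ≃ₗᵢ[ℂ] A) : Set (selfAdjointDual A) :=
  {ω | (∀ b : A, 0 ≤ ((ω : StrongDual ℂ A) (star b * b)).re) ∧
    IsNormalFunctional e (ω : StrongDual ℂ A)}

/-- The self-adjoint functionals `η` that are absolutely continuous with respect to `ω`: for every
`ε > 0` there is `δ > 0` such that `|η a| < ε` for all positive `a` in the unit ball with
`ω a < δ`. -/
def absolutelyContinuousFunctionals {A : Type*} [CStarAlgebra A]
    (ω : selfAdjointDual A) : Set (selfAdjointDual A) :=
  {η | ∀ ε : ℝ, 0 < ε → ∃ δ : ℝ, 0 < δ ∧ ∀ a : A, (∃ b : A, a = star b * b) → ‖a‖ ≤ 1 →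
    ((ω : StrongDual ℂ A) a).re < δ → |((η : StrongDual ℂ A) a).re| < ε}

end

/-! If a curve in the cone has velocity `η` at `ω`, then `ω ± t η` is positive up to `o(t)`. Hence
`|η a| ≤ ω a / t + o(1)` for positive `a` in the unit ball, which is absolute continuity, a
norm-closed condition.

Conversely, for self-adjoint `b` the functionals `a ↦ ω ((1 + t b) a (1 + t b))` are positive and
quadratic in `t`, with velocity `jordanTranslate b ω`. Two facts finish the proof.

Density (`exists_isSelfAdjoint_abs_re_le`): on the convex set of self-adjoint `a` in the unit ball
with `η a ≥ d`, absolute continuity bounds `ω (a * a)` away from `0`. At a near-minimiser `b` the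
first variation `jordanTranslate b ω` is strictly positive on the whole set. So `η` is at most `d`
in modulus on the kernel of that functional in the self-adjoint unit ball, and Hahn-Banach puts a
real multiple of it close to `η`.

Normality of the curve (`WeakStarTendsto.jordan_mul`): Jordan multiplication is weak-⋆ continuous on
bounded sets. Only the predual is used: self-adjointness is expressed by norm bounds, which survive
weak-⋆ limits. -/

open Filter Topology

/-- A bounded functional that is at most `ε` on the part of the unit ball where finitely many
functionals vanish is within `ε` of the span of these functionals. -/
theorem exists_norm_sub_sum_smul_le {𝕜 E ι : Type*} [RCLike 𝕜] [NormedAddCommGroup E]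
    [NormedSpace 𝕜 E] [Fintype ι] (L : ι → StrongDual 𝕜 E) (f : StrongDual 𝕜 E) {ε : ℝ}
    (hε : 0 ≤ ε) (h : ∀ a, (∀ i, L i a = 0) → ‖a‖ ≤ 1 → ‖f a‖ ≤ ε) :
    ∃ c : ι → 𝕜, ‖f - ∑ i, c i • L i‖ ≤ ε := by
  let N : Submodule 𝕜 E := ⨅ i, LinearMap.ker (L i : E →ₗ[𝕜] 𝕜)
  have hN : ∀ a ∈ N, ∀ i, L i a = 0 := fun a ha i => by
    simpa using (Submodule.mem_iInf _).1 ha i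
  -- Hahn-Banach: `g` extends `f` restricted to the common kernel without increasing the norm, so `f
  -- - g` vanishes there and lies in the span.
  obtain ⟨g, hg, hgn⟩ := exists_extension_norm_eq N (f.comp N.subtypeL)
  have hgε : ‖g‖ ≤ ε := by
    rw [hgn]
    refine ContinuousLinearMap.opNorm_le_of_unit_norm hε fun x hx => ?_
    exact h x (hN x x.2) (le_of_eq hx)
  have hspan : ((f - g : StrongDual 𝕜 E) : E →ₗ[𝕜] 𝕜) ∈
      Submodule.span 𝕜 (Set.range fun i => (L i : E →ₗ[𝕜] 𝕜)) := by
    refine mem_span_of_iInf_ker_le_ker fun a ha => ?_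
    have := hg ⟨a, ha⟩
    simp at this
    simp [this]
  obtain ⟨c, hc⟩ := (Submodule.mem_span_range_iff_exists_fun 𝕜).1 hspan
  refine ⟨c, ?_⟩
  have : f - ∑ i, c i • L i = g := by
    ext a
    have := congrArg (fun F : E →ₗ[𝕜] 𝕜 => F a) hc
    simp [LinearMap.sum_apply] at this
    simp [this]
  rwa [this]

/-! ### Self-adjointness from norm estimates -/

section NormTrick

variable {A : Type*} [CStarAlgebra A]

/-- A spectral value `l` satisfies `(l + n) ^ 2 ≤ M + n ^ 2`, so `2 n l ≤ M` for every real `n`, of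
either sign. -/
theorem eq_zero_of_isSelfAdjoint_of_norm_add_le {q : A} (hq : IsSelfAdjoint q) {M : ℝ}
    (h : ∀ n : ℝ, ‖q + algebraMap ℝ A n‖ ^ 2 ≤ M + n ^ 2) : q = 0 := by
  nontriviality A
  have hs : ∀ l ∈ spectrum ℝ q, l = 0 := by
    intro l hl
    have key : ∀ n : ℝ, 2 * n * l ≤ M := by
      intro n
      have h1 : l + n ∈ spectrum ℝ (q + algebraMap ℝ A n) := by
        simpa [add_comm] using (spectrum.add_mem_add_iff (r := l) (s := n)).2 hl
      have h2 : |l + n| ≤ ‖q + algebraMap ℝ A n‖ := by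
        simpa using spectrum.norm_le_norm_of_mem h1
      have h3 := pow_le_pow_left₀ (abs_nonneg _) h2 2
      rw [sq_abs] at h3
      nlinarith [h n, sq_nonneg l]
    by_contra hl0
    have := key ((M + 1) / (2 * l))
    have h2 : 2 * ((M + 1) / (2 * l)) * l = M + 1 := by field_simp
    linarith
  rw [← cfc_id' ℝ q, cfc_congr (g := fun _ => (0 : ℝ)) hs, cfc_const_zero]

open Complex in
-- Adding `i n` shifts the imaginary part by `n`, and taking imaginary parts does not increase the
-- norm.
theorem isSelfAdjoint_of_norm_add_I_smul_le {w : A} {M : ℝ}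
    (h : ∀ n : ℝ, ‖w + (I * n) • (1 : A)‖ ^ 2 ≤ M + n ^ 2) : IsSelfAdjoint w := by
  have hq : ((imaginaryPart w : selfAdjoint A) : A) = 0 := by
    refine eq_zero_of_isSelfAdjoint_of_norm_add_le (imaginaryPart w).2 (M := M) fun n => ?_
    have h1 : ((imaginaryPart w : selfAdjoint A) : A) + algebraMap ℝ A n =
        (imaginaryPart (w + (I * n) • (1 : A)) : selfAdjoint A) := by
      rw [mul_smul, map_add, imaginaryPart_I_smul, Algebra.algebraMap_eq_smul_one,
        AddSubgroup.coe_add]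
      congr 1
      have : IsSelfAdjoint ((n : ℂ) • (1 : A)) := by
        simp [IsSelfAdjoint, star_smul]
      rw [this.coe_realPart, Complex.coe_smul]
    rw [h1]
    refine le_trans ?_ (h n)
    gcongr
    exact imaginaryPart.norm_le (w + (I * n) • (1 : A))
  rw [← realPart_add_I_smul_imaginaryPart w, hq]
  simp

open Complex in
theorem IsSelfAdjoint.norm_add_I_smul_sq_le {a : A} (ha : IsSelfAdjoint a) (n : ℝ) :
    ‖a + (I * n) • (1 : A)‖ ^ 2 ≤ ‖a‖ ^ 2 + n ^ 2 := by
  rcases subsingleton_or_nontrivial A with hA | hA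
  · rw [Subsingleton.elim (a + (I * n) • (1 : A)) 0, norm_zero, zero_pow two_ne_zero]
    positivity
  have h : star (a + (I * n) • (1 : A)) * (a + (I * n) • (1 : A)) =
      a * a + ((n : ℂ) ^ 2) • (1 : A) := by
    simp only [star_add, ha.star_eq, star_smul, star_one, star_mul', Complex.star_def, conj_I,
      Complex.conj_ofReal, add_mul, mul_add, smul_mul_assoc, mul_smul_comm, one_mul, mul_one]
    have : -I * n * (I * n) = (n : ℂ) ^ 2 := by linear_combination (-(n : ℂ) ^ 2) * I_sq
    linear_combination (norm := module) this • (1 : A)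
  rw [sq, ← CStarRing.norm_star_mul_self, h]
  refine (norm_add_le _ _).trans ?_
  gcongr
  · rw [sq]; exact norm_mul_le _ _
  · simp [norm_smul]

end NormTrick

/-! ### Weak-⋆ limits and Jordan multiplication -/

section WeakStar

variable {A : Type*} [CStarAlgebra A] {X : Type*} [NormedAddCommGroup X] [NormedSpace ℂ X]
  (e : StrongDual ℂ X ≃ₗᵢ[ℂ] A) {ι : Type*}

/-- `g` converges to `w` along `F` in the weak-⋆ topology defined by the predual `X`. -/
def WeakStarTendsto (g : ι → A) (F : Filter ι) (w : A) : Prop :=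
  ∀ x : X, Tendsto (fun i => e.symm (g i) x) F (𝓝 (e.symm w x))

variable {e}

theorem WeakStarTendsto.add {g h : ι → A} {F : Filter ι} {v w : A}
    (hg : WeakStarTendsto e g F v) (hh : WeakStarTendsto e h F w) :
    WeakStarTendsto e (fun i => g i + h i) F (v + w) := fun x => by
  simpa using (hg x).add (hh x)

theorem WeakStarTendsto.smul {g : ι → A} {F : Filter ι} {v : A} (c : ℂ)
    (hg : WeakStarTendsto e g F v) : WeakStarTendsto e (fun i => c • g i) F (c • v) := fun x => by
  simpa using (hg x).const_mul c

theorem WeakStarTendsto.sub {g h : ι → A} {F : Filter ι} {v w : A}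
    (hg : WeakStarTendsto e g F v) (hh : WeakStarTendsto e h F w) :
    WeakStarTendsto e (fun i => g i - h i) F (v - w) := fun x => by
  simpa using (hg x).sub (hh x)

theorem weakStarTendsto_const (v : A) (F : Filter ι) :
    WeakStarTendsto e (fun _ => v) F v := fun _ => tendsto_const_nhds

theorem WeakStarTendsto.unique {g : ι → A} {F : Filter ι} [F.NeBot] {v w : A}
    (hv : WeakStarTendsto e g F v) (hw : WeakStarTendsto e g F w) : v = w :=
  e.symm.injective <| ContinuousLinearMap.ext fun x => tendsto_nhds_unique (hv x) (hw x)

theorem WeakStarTendsto.norm_le {g : ι → A} {F : Filter ι} [F.NeBot] {w : A} {M : ℝ}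
    (hw : WeakStarTendsto e g F w) (hM : 0 ≤ M) (hg : ∀ i, ‖g i‖ ≤ M) : ‖w‖ ≤ M := by
  rw [← e.symm.norm_map]
  refine ContinuousLinearMap.opNorm_le_bound _ hM fun x => ?_
  refine le_of_tendsto (hw x).norm (Eventually.of_forall fun i => ?_)
  refine (ContinuousLinearMap.le_opNorm _ _).trans ?_
  rw [e.symm.norm_map]
  gcongr
  exact hg i

theorem exists_weakStarTendsto (F : Ultrafilter ι) {g : ι → A} {M : ℝ} (hg : ∀ i, ‖g i‖ ≤ M) :
    ∃ w, WeakStarTendsto e g F w := by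
  have hK := WeakDual.isCompact_closedBall (𝕜 := ℂ) (0 : StrongDual ℂ X) M
  let G : ι → WeakDual ℂ X := fun i => StrongDual.toWeakDual (e.symm (g i))
  obtain ⟨v, -, hv⟩ := isCompact_iff_ultrafilter_le_nhds.1 hK (F.map G) (by
    rw [le_principal_iff]
    refine Ultrafilter.mem_map.2 (Eventually.of_forall fun i => ?_)
    simp [G, hg i])
  refine ⟨e (WeakDual.toStrongDual v), fun x => ?_⟩
  have h1 : Tendsto G F (𝓝 v) := hv
  rw [e.symm_apply_apply]
  exact ((WeakDual.eval_continuous x).tendsto v).comp h1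

open Complex

/-- The norm criterion for self-adjointness passes to the limit because closed balls are weak-⋆
closed. Multiplying by a unitary preserves norms, so no continuity of multiplication is needed. -/
theorem WeakStarTendsto.isSelfAdjoint_star_mul {g : ι → A} {F : Filter ι} [F.NeBot] {w u : A}
    {M : ℝ} (hu : u ∈ unitary A) (hsa : ∀ i, IsSelfAdjoint (g i)) (hM : ∀ i, ‖g i‖ ≤ M)
    (hw : WeakStarTendsto e (fun i => u * g i) F w) : IsSelfAdjoint (star u * w) := by
  refine isSelfAdjoint_of_norm_add_I_smul_le (M := M ^ 2) fun n => ?_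
  have h1 : WeakStarTendsto e (fun i => u * g i + (I * n) • u) F (w + (I * n) • u) :=
    hw.add (weakStarTendsto_const _ _)
  have h2 : ‖w + (I * n) • u‖ ≤ √(M ^ 2 + n ^ 2) := by
    refine h1.norm_le (Real.sqrt_nonneg _) fun i => Real.le_sqrt_of_sq_le ?_
    have h3 : u * g i + (I * n) • u = u * (g i + (I * n) • (1 : A)) := by simp [mul_add]
    rw [h3, CStarRing.norm_mem_unitary_mul _ hu]
    refine ((hsa i).norm_add_I_smul_sq_le n).trans ?_
    gcongr
    exact hM i
  have h4 : star u * w + (I * n) • (1 : A) = star u * (w + (I * n) • u) := by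
    simp [mul_add, Unitary.star_mul_self_of_mem hu]
  rw [h4, CStarRing.norm_mem_unitary_mul _ (Unitary.star_mem hu)]
  calc _ ≤ √(M ^ 2 + n ^ 2) ^ 2 := by gcongr
    _ = _ := Real.sq_sqrt (by positivity)

theorem WeakStarTendsto.isSelfAdjoint {g : ι → A} {F : Filter ι} [F.NeBot] {w : A}
    {M : ℝ} (hsa : ∀ i, IsSelfAdjoint (g i)) (hM : ∀ i, ‖g i‖ ≤ M)
    (hw : WeakStarTendsto e g F w) : IsSelfAdjoint w := by
  have := WeakStarTendsto.isSelfAdjoint_star_mul (u := (1 : A)) (w := w) (one_mem _) hsa hM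
    (by simpa using hw)
  simpa using this

theorem WeakStarTendsto.star_of_norm_le {g : ι → A} {F : Ultrafilter ι} {w : A} {M : ℝ}
    (hM : ∀ i, ‖g i‖ ≤ M) (hw : WeakStarTendsto e g F w) :
    WeakStarTendsto e (fun i => star (g i)) F (star w) := by
  have hp : ∀ i, ‖((realPart (g i) : selfAdjoint A) : A)‖ ≤ M := fun i =>
    (realPart.norm_le (g i)).trans (hM i)
  have hq : ∀ i, ‖((imaginaryPart (g i) : selfAdjoint A) : A)‖ ≤ M := fun i =>
    (imaginaryPart.norm_le (g i)).trans (hM i)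
  obtain ⟨p, hpt⟩ := exists_weakStarTendsto (e := e) F hp
  obtain ⟨q, hqt⟩ := exists_weakStarTendsto (e := e) F hq
  have hps : IsSelfAdjoint p := hpt.isSelfAdjoint (fun i => (realPart (g i)).2) hp
  have hqs : IsSelfAdjoint q := hqt.isSelfAdjoint (fun i => (imaginaryPart (g i)).2) hq
  have h1 := hpt.add (hqt.smul I)
  simp only [realPart_add_I_smul_imaginaryPart] at h1
  have h2 := hpt.sub (hqt.smul I)
  have h3 : (fun i => star (g i)) = fun i =>
      ((realPart (g i) : selfAdjoint A) : A) - I • ((imaginaryPart (g i) : selfAdjoint A) : A) := by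
    ext i
    conv_lhs => rw [← realPart_add_I_smul_imaginaryPart (g i)]
    simp [star_smul, sub_eq_add_neg]
  rw [h3, hw.unique h1]
  convert h2 using 1
  simp [star_smul, hps.star_eq, hqs.star_eq, sub_eq_add_neg]

theorem hasDerivAt_exp_I_smul (c : A) :
    HasDerivAt (fun t : ℝ => NormedSpace.exp (I • (t • c))) (I • c) 0 := by
  have h := hasDerivAt_exp_smul_const (𝕂 := ℝ) (I • c) (0 : ℝ)
  simp only [zero_smul, NormedSpace.exp_zero, one_mul] at h
  simpa only [smul_comm I] using h

/-- With `w = lim c * g i` and `u t = exp (i t c)`, the limit `D t` of `u t * g i` is `i t w +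
o(t)`, while `star (u t) * D t` is self-adjoint. Dividing by `t` shows that `i w` is self-adjoint,
so `star w = -w` and `c * g i + g i * c` tends to `w + star w = 0`. -/
theorem WeakStarTendsto.jordan_mul_of_isSelfAdjoint {g : ι → A} {F : Ultrafilter ι} {M : ℝ} {c : A}
    (hc : IsSelfAdjoint c) (hsa : ∀ i, IsSelfAdjoint (g i)) (hM : ∀ i, ‖g i‖ ≤ M)
    (hg : WeakStarTendsto e g F 0) :
    WeakStarTendsto e (fun i => c * g i + g i * c) F 0 := by
  have hM0 : 0 ≤ M := by
    obtain ⟨i⟩ : Nonempty ι := F.nonempty_of_mem (F.univ_mem) |>.to_type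
    exact (norm_nonneg _).trans (hM i)
  have hcg : ∀ i, ‖c * g i‖ ≤ ‖c‖ * M := fun i => (norm_mul_le _ _).trans (by gcongr; exact hM i)
  obtain ⟨w, hw⟩ := exists_weakStarTendsto (e := e) F hcg
  let u : ℝ → A := fun t => NormedSpace.exp (I • (t • c))
  have hu : ∀ t, u t ∈ unitary A := fun t =>
    (selfAdjoint.expUnitary (⟨t • c, (IsSelfAdjoint.all t).smul hc⟩ : selfAdjoint A)).2
  have hu0 : u 0 = 1 := by simp [u]
  have hD : ∀ t, ∃ D, WeakStarTendsto e (fun i => u t * g i) F D := fun t =>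
    exists_weakStarTendsto (e := e) (M := M) F fun i => by
      rw [CStarRing.norm_mem_unitary_mul _ (hu t)]; exact hM i
  choose D hD using hD
  have hS : ∀ t, IsSelfAdjoint (star (u t) * D t) := fun t =>
    (hD t).isSelfAdjoint_star_mul (hu t) hsa hM
  have hDt : ∀ t : ℝ, ‖D t - (t * I) • w‖ ≤ ‖u t - u 0 - t • (I • c)‖ * M := by
    intro t
    have h1 := ((hD t).sub (hw.smul (t * I))).sub hg
    rw [sub_zero] at h1
    refine h1.norm_le (by positivity) fun i => ?_
    have h2 : u t * g i - (t * I) • (c * g i) - g i = (u t - u 0 - t • (I • c)) * g i := by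
      simp only [hu0, sub_mul, one_mul, smul_mul_assoc, mul_smul, Complex.coe_smul]
      abel
    rw [h2]
    exact (norm_mul_le _ _).trans (by gcongr; exact hM i)
  have hder : HasDerivAt u (I • c) 0 := hasDerivAt_exp_I_smul c
  have hIw : IsSelfAdjoint (I • w) := by
    have hlim : Tendsto (fun t : ℝ => t⁻¹ • (star (u t) * D t)) (𝓝[≠] 0) (𝓝 (I • w)) := by
      rw [tendsto_iff_norm_sub_tendsto_zero]
      have hz : Tendsto (fun t : ℝ => ‖t⁻¹ • (u t - u 0) - I • c‖ * M + ‖star (u t) - 1‖ * ‖I • w‖)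
          (𝓝[≠] 0) (𝓝 0) := by
        have h1 : Tendsto (fun t : ℝ => ‖t⁻¹ • (u t - u 0) - I • c‖) (𝓝[≠] 0) (𝓝 0) := by
          have := hder.tendsto_slope_zero
          simp only [zero_add] at this
          exact tendsto_iff_norm_sub_tendsto_zero.1 this
        have h2 : Tendsto (fun t : ℝ => ‖star (u t) - 1‖) (𝓝[≠] 0) (𝓝 0) := by
          have h3 : Tendsto (fun t => star (u t)) (𝓝 0) (𝓝 (star (u 0))) :=
            hder.continuousAt.tendsto.star
          rw [hu0, star_one] at h3
          exact (tendsto_iff_norm_sub_tendsto_zero.1 h3).mono_left nhdsWithin_le_nhds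
        simpa using (h1.mul_const M).add (h2.mul_const ‖I • w‖)
      refine squeeze_zero' (Eventually.of_forall fun _ => norm_nonneg _) ?_ hz
      filter_upwards [self_mem_nhdsWithin] with t ht
      have ht' : t ≠ 0 := ht
      have h1 : t⁻¹ • (star (u t) * D t) - I • w =
          t⁻¹ • (star (u t) * (D t - (t * I) • w)) + (star (u t) - 1) * (I • w) := by
        rw [mul_smul, Complex.coe_smul, mul_sub, smul_sub, mul_smul_comm, inv_smul_smul₀ ht',
          sub_mul, one_mul]
        abel
      rw [h1]
      refine (norm_add_le _ _).trans (add_le_add ?_ (norm_mul_le _ _))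
      rw [norm_smul, CStarRing.norm_mem_unitary_mul _ (Unitary.star_mem (hu t))]
      have h2 : t⁻¹ • (u t - u 0) - I • c = t⁻¹ • (u t - u 0 - t • (I • c)) := by
        rw [smul_sub t⁻¹ (u t - u 0), smul_smul t⁻¹ t, inv_mul_cancel₀ ht', one_smul]
      rw [h2, norm_smul, mul_assoc]
      gcongr
      exact hDt t
    exact (isClosed_eq continuous_star continuous_id).mem_of_tendsto hlim (Eventually.of_forall fun t =>
      (IsSelfAdjoint.all _).smul (hS t))
  have hws : star w = -w := by
    have := hIw.star_eq
    rw [star_smul, Complex.star_def, conj_I, neg_smul, neg_eq_iff_eq_neg, ← smul_neg] at this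
    exact smul_right_injective A I_ne_zero this
  have h := hw.add (hw.star_of_norm_le hcg)
  rw [hws, add_neg_cancel] at h
  simpa only [star_mul, (hsa _).star_eq, hc.star_eq] using h

theorem WeakStarTendsto.jordan_mul {g : ι → A} {F : Ultrafilter ι} {M : ℝ} {c : A}
    (hc : IsSelfAdjoint c) (hM : ∀ i, ‖g i‖ ≤ M) (hg : WeakStarTendsto e g F 0) :
    WeakStarTendsto e (fun i => c * g i + g i * c) F 0 := by
  have hs := hg.star_of_norm_le hM
  rw [star_zero] at hs
  have hM' : ∀ i, ‖star (g i)‖ ≤ M := fun i => by rw [norm_star]; exact hM i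
  have h1 : WeakStarTendsto e (fun i => g i + star (g i)) F 0 := by simpa using hg.add hs
  have h2 : WeakStarTendsto e (fun i => I • (g i - star (g i))) F 0 := by
    simpa using (hg.sub hs).smul I
  have h3 := h1.jordan_mul_of_isSelfAdjoint (M := M + M) hc
    (fun i => IsSelfAdjoint.add_star_self (g i))
    (fun i => (norm_add_le _ _).trans (add_le_add (hM i) (hM' i)))
  have h4 := h2.jordan_mul_of_isSelfAdjoint (M := M + M) hc
    (fun i => by simp [IsSelfAdjoint, star_smul, ← smul_neg])
    (fun i => by
      rw [norm_smul, norm_I, one_mul]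
      exact (norm_sub_le _ _).trans (add_le_add (hM i) (hM' i)))
  -- Recombines `g` from twice its real part and minus twice its imaginary part.
  have h5 := (h3.sub (h4.smul I)).smul (1 / 2)
  simp only [smul_zero, sub_zero] at h5
  convert h5 using 2 with i
  simp only [mul_smul_comm, smul_mul_assoc, smul_add, smul_smul, I_mul_I, smul_sub,
    mul_add, add_mul, mul_sub, sub_mul]
  module

end WeakStar

/-! ### Normal functionals and their translates -/

section Normal

open Complex

variable {A : Type*} [CStarAlgebra A] {X : Type*} [NormedAddCommGroup X] [NormedSpace ℂ X]
  {e : StrongDual ℂ X ≃ₗᵢ[ℂ] A}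

/-- The functional `a ↦ φ (c * a) + φ (a * c)`. -/
noncomputable def jordanTranslate (c : A) (φ : StrongDual ℂ A) : StrongDual ℂ A :=
  φ.comp (ContinuousLinearMap.mul ℂ A c) + φ.comp ((ContinuousLinearMap.mul ℂ A).flip c)

@[simp]
theorem jordanTranslate_apply (c : A) (φ : StrongDual ℂ A) (a : A) :
    jordanTranslate c φ a = φ (c * a) + φ (a * c) := rfl

theorem IsNormalFunctional.add {φ ψ : StrongDual ℂ A} (hφ : IsNormalFunctional e φ)
    (hψ : IsNormalFunctional e ψ) : IsNormalFunctional e (φ + ψ) := by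
  obtain ⟨x, hx⟩ := hφ
  obtain ⟨y, hy⟩ := hψ
  exact ⟨x + y, fun a => by simp [hx, hy]⟩

theorem IsNormalFunctional.smul {φ : StrongDual ℂ A} (c : ℂ) (hφ : IsNormalFunctional e φ) :
    IsNormalFunctional e (c • φ) := by
  obtain ⟨x, hx⟩ := hφ
  exact ⟨c • x, fun a => by simp [hx]⟩

variable (e) in
/-- Evaluation at a point of the predual, as a functional on the algebra. -/
noncomputable def evalPredual : X →ₗᵢ[ℂ] StrongDual ℂ A where
  toFun x := (NormedSpace.inclusionInDoubleDual ℂ X x).comp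
    (e.symm.toContinuousLinearEquiv : A →L[ℂ] StrongDual ℂ X)
  map_add' x y := by ext; simp
  map_smul' c x := by ext; simp
  norm_map' x := by
    refine le_antisymm ?_ ?_
    · refine ContinuousLinearMap.opNorm_le_bound _ (norm_nonneg _) fun a => ?_
      have := (e.symm a).le_opNorm x
      rw [e.symm.norm_map] at this
      simpa [mul_comm] using this
    · refine NormedSpace.norm_le_dual_bound ℂ x (norm_nonneg _) fun f => ?_
      have := ((NormedSpace.inclusionInDoubleDual ℂ X x).comp
        (e.symm.toContinuousLinearEquiv : A →L[ℂ] StrongDual ℂ X)).le_opNorm (e f)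
      rw [e.norm_map] at this
      simpa using this

theorem isNormalFunctional_iff_mem_range {φ : StrongDual ℂ A} :
    IsNormalFunctional e φ ↔ φ ∈ Set.range (evalPredual e) := by
  constructor
  · rintro ⟨x, hx⟩
    exact ⟨x, ContinuousLinearMap.ext fun a => (hx a).symm⟩
  · rintro ⟨x, rfl⟩
    exact ⟨x, fun a => rfl⟩

/-- A functional that is weak-⋆ continuous at `0` on the unit ball is normal. -/
theorem isNormalFunctional_of_tendsto [CompleteSpace X] {f : StrongDual ℂ A}
    (hf : ∀ F : Ultrafilter (Metric.closedBall (0 : A) 1),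
      WeakStarTendsto e (fun a : Metric.closedBall (0 : A) 1 => (a : A)) F 0 →
        Tendsto (fun a : Metric.closedBall (0 : A) 1 => f a) F (𝓝 0)) :
    IsNormalFunctional e f := by
  -- The predual is complete and embeds isometrically, so its image is closed and approximation
  -- suffices.
  rw [isNormalFunctional_iff_mem_range,
    ← (evalPredual e).isometry.isClosedEmbedding.isClosed_range.closure_eq,
    Metric.mem_closure_iff]
  intro ε hε
  let T : Metric.closedBall (0 : A) 1 → X → ℂ := fun a x => e.symm (a : A) x
  have h1 : Tendsto (fun a : Metric.closedBall (0 : A) 1 => f a) (comap T (𝓝 0)) (𝓝 0) := by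
    rw [tendsto_iff_ultrafilter]
    intro F hF
    refine hf F fun x => ?_
    have h2 := tendsto_pi_nhds.1 (tendsto_iff_comap.2 hF) x
    simpa [T] using h2
  have h2 := h1 (Metric.closedBall_mem_nhds 0 (half_pos hε))
  rw [mem_map, mem_comap] at h2
  obtain ⟨U, hU, hUf⟩ := h2
  rw [nhds_pi, mem_pi] at hU
  obtain ⟨I, hI, t, ht, htU⟩ := hU
  have := hI.fintype
  -- A basic weak-⋆ neighbourhood of `0` in the ball involves finitely many predual points; their
  -- span contains the approximant.
  obtain ⟨c, hc⟩ := exists_norm_sub_sum_smul_le (fun x : I => evalPredual e (x : X)) f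
    (half_pos hε).le fun a ha han => by
      have h3 : (⟨a, by simpa using han⟩ : Metric.closedBall (0 : A) 1) ∈ T ⁻¹' U :=
        htU fun x hx => by
          have h4 : T ⟨a, by simpa using han⟩ x = 0 := ha ⟨x, hx⟩
          rw [h4]
          exact mem_of_mem_nhds (ht x)
      simpa using hUf h3
  refine ⟨_, ⟨∑ x, c x • (x : X), rfl⟩, ?_⟩
  rw [dist_eq_norm]
  refine lt_of_le_of_lt ?_ (half_lt_self hε)
  simpa [map_sum] using hc

theorem IsNormalFunctional.jordanTranslate [CompleteSpace X] {φ : StrongDual ℂ A} {c : A}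
    (hφ : IsNormalFunctional e φ) (hc : IsSelfAdjoint c) :
    IsNormalFunctional e (jordanTranslate c φ) := by
  obtain ⟨x, hx⟩ := hφ
  refine isNormalFunctional_of_tendsto fun F hF => ?_
  have h := hF.jordan_mul hc (M := 1) (fun a => mem_closedBall_zero_iff.1 a.2) x
  simpa [← hx] using h

/-- The functional `a ↦ φ (b * a * b)`. -/
noncomputable def conjTranslate (b : A) (φ : StrongDual ℂ A) : StrongDual ℂ A :=
  φ.comp ((ContinuousLinearMap.mul ℂ A b).comp ((ContinuousLinearMap.mul ℂ A).flip b))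

@[simp]
theorem conjTranslate_apply (b : A) (φ : StrongDual ℂ A) (a : A) :
    conjTranslate b φ a = φ (b * (a * b)) := rfl

theorem IsNormalFunctional.conjTranslate [CompleteSpace X] {φ : StrongDual ℂ A} {b : A}
    (hφ : IsNormalFunctional e φ) (hb : IsSelfAdjoint b) :
    IsNormalFunctional e (conjTranslate b φ) := by
  -- Translating twice by `b` and subtracting the translate by `b * b` leaves `2 φ (b a b)`.
  have h1 := ((hφ.jordanTranslate hb).jordanTranslate hb).add
    ((hφ.jordanTranslate (c := b * b) (by simpa [sq] using hb.pow 2)).smul (-1))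
  convert h1.smul (1 / 2) using 1
  ext a
  simp [mul_add, mul_assoc]
  ring

end Normal

/-! ### Approximation by Jordan translates -/

section SelfAdjointDual

open Complex

variable {A : Type*} [CStarAlgebra A]

theorem jordanTranslate_mem_selfAdjointDual {φ : StrongDual ℂ A} (hφ : φ ∈ selfAdjointDual A)
    {c : A} (hc : IsSelfAdjoint c) : jordanTranslate c φ ∈ selfAdjointDual A := fun a ha => by
  rw [jordanTranslate_apply, ← map_add]
  refine hφ _ ?_
  simp [IsSelfAdjoint, ha.star_eq, hc.star_eq, add_comm]

theorem conjTranslate_mem_selfAdjointDual {φ : StrongDual ℂ A} (hφ : φ ∈ selfAdjointDual A)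
    {c : A} (hc : IsSelfAdjoint c) : conjTranslate c φ ∈ selfAdjointDual A := fun a ha => by
  rw [conjTranslate_apply]
  refine hφ _ ?_
  simp [IsSelfAdjoint, ha.star_eq, hc.star_eq, mul_assoc]

/-- The real part of a functional, as a real functional. -/
noncomputable def reFunctional (φ : StrongDual ℂ A) : StrongDual ℝ A :=
  reCLM.comp (φ.restrictScalars ℝ)

@[simp]
theorem reFunctional_apply (φ : StrongDual ℂ A) (a : A) : reFunctional φ a = (φ a).re := rfl

theorem norm_le_of_norm_reFunctional_le {φ : StrongDual ℂ A} {d : ℝ}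
    (h : ‖reFunctional φ‖ ≤ d) : ‖φ‖ ≤ 2 * d := by
  have hre : ∀ a, |(φ a).re| ≤ d * ‖a‖ := fun a => by
    have := (reFunctional φ).le_of_opNorm_le h a
    simpa using this
  have hd : 0 ≤ d := (norm_nonneg _).trans h
  refine ContinuousLinearMap.opNorm_le_bound _ (by positivity) fun a => ?_
  have h1 := hre (I • a)
  have h2 := hre a
  simp only [map_smul, smul_eq_mul, mul_re, I_re, I_im, zero_mul, one_mul, zero_sub, abs_neg,
    norm_smul, norm_I] at h1
  linarith [norm_le_abs_re_add_abs_im (φ a)]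

theorem re_apply_realPart {φ : StrongDual ℂ A} (hφ : φ ∈ selfAdjointDual A) (a : A) :
    (φ ((realPart a : selfAdjoint A) : A)).re = (φ a).re := by
  conv_rhs => rw [← realPart_add_I_smul_imaginaryPart a]
  simp [hφ _ (imaginaryPart a).2]

/-- Decomposition of a self-adjoint element of the unit ball into its positive and negative
parts. -/
theorem exists_posPart_negPart {a : A} (ha : IsSelfAdjoint a) (hn : ‖a‖ ≤ 1) :
    ∃ p n : A, (∃ b, p = star b * b) ∧ (∃ b, n = star b * b) ∧ ‖p‖ ≤ 1 ∧ ‖n‖ ≤ 1 ∧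
      a = p - n ∧ p * p + n * n = a * a ∧ IsSelfAdjoint p ∧ IsSelfAdjoint n := by
  have hspec : ∀ x ∈ spectrum ℝ a, |x| ≤ 1 := fun x hx => by
    rcases subsingleton_or_nontrivial A with hA | hA
    · simp [spectrum.of_subsingleton] at hx
    · exact (spectrum.norm_le_norm_of_mem hx).trans hn
  have hsq : ∀ f : ℝ → ℝ, Continuous f → (∀ x, 0 ≤ f x) → ∃ b, cfc f a = star b * b :=
    fun f hf h0 => by
      refine ⟨cfc (fun x => √(f x)) a, ?_⟩
      rw [(cfc_predicate (fun x => √(f x)) a : IsSelfAdjoint _).star_eq,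
        ← cfc_mul (fun x => √(f x)) (fun x => √(f x)) a (by fun_prop) (by fun_prop)]
      exact cfc_congr fun x _ => (Real.mul_self_sqrt (h0 x)).symm
  refine ⟨cfc (fun x : ℝ => max x 0) a, cfc (fun x : ℝ => max (-x) 0) a,
    hsq _ (by fun_prop) fun x => le_max_right _ _, hsq _ (by fun_prop) fun x => le_max_right _ _,
    norm_cfc_le zero_le_one fun x hx => ?_, norm_cfc_le zero_le_one fun x hx => ?_, ?_, ?_,
    cfc_predicate _ a, cfc_predicate _ a⟩
  · have := abs_le.1 (hspec x hx)
    rw [Real.norm_of_nonneg (le_max_right _ _)]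
    exact max_le this.2 zero_le_one
  · have := abs_le.1 (hspec x hx)
    rw [Real.norm_of_nonneg (le_max_right _ _)]
    exact max_le (by linarith) zero_le_one
  · rw [← cfc_sub (fun x : ℝ => max x 0) (fun x : ℝ => max (-x) 0) a (by fun_prop) (by fun_prop)]
    conv_lhs => rw [← cfc_id' ℝ a]
    refine cfc_congr fun x _ => ?_
    rcases le_total x 0 with h | h <;> simp [h]
  · rw [← cfc_mul (fun x : ℝ => max x 0) (fun x : ℝ => max x 0) a (by fun_prop) (by fun_prop),
      ← cfc_mul (fun x : ℝ => max (-x) 0) (fun x : ℝ => max (-x) 0) a (by fun_prop) (by fun_prop),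
      ← cfc_add a (fun x : ℝ => max x 0 * max x 0) (fun x : ℝ => max (-x) 0 * max (-x) 0)
        (by fun_prop) (by fun_prop)]
    have h : a * a = cfc (fun x : ℝ => x * x) a := by
      rw [cfc_mul (fun x : ℝ => x) (fun x : ℝ => x) a (by fun_prop) (by fun_prop), cfc_id' ℝ a]
    rw [h]
    refine cfc_congr fun x _ => ?_
    rcases le_total x 0 with h | h <;> simp [h]

theorem re_apply_le_of_re_apply_mul_self {φ : StrongDual ℂ A}
    (hφ : ∀ b : A, 0 ≤ (φ (star b * b)).re) {p : A} (hp : IsSelfAdjoint p) {k : ℝ} :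
    2 * k * (φ p).re ≤ k ^ 2 * (φ 1).re + (φ (p * p)).re := by
  have h := hφ ((k : ℂ) • (1 : A) - p)
  have h1 : star ((k : ℂ) • (1 : A) - p) * ((k : ℂ) • (1 : A) - p) =
      ((k ^ 2 : ℝ) : ℂ) • (1 : A) - ((2 * k : ℝ) : ℂ) • p + p * p := by
    simp only [star_sub, star_smul, star_one, hp.star_eq, Complex.star_def, conj_ofReal, mul_sub,
      sub_mul, smul_mul_assoc, mul_smul_comm, one_mul, mul_one, smul_sub]
    push_cast
    module
  rw [h1, map_add, map_sub, map_smul, map_smul, smul_eq_mul, smul_eq_mul, add_re, sub_re,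
    re_ofReal_mul, re_ofReal_mul] at h
  linarith

/-- An absolutely continuous functional is small on self-adjoint elements of the unit ball that are
small in the `L²` seminorm. -/
theorem exists_abs_re_lt_of_re_mul_self_lt {ω η : selfAdjointDual A}
    (hω : ∀ b : A, 0 ≤ ((ω : StrongDual ℂ A) (star b * b)).re)
    (hη : η ∈ absolutelyContinuousFunctionals ω) {d : ℝ} (hd : 0 < d) :
    ∃ κ : ℝ, 0 < κ ∧ ∀ a : A, IsSelfAdjoint a → ‖a‖ ≤ 1 →
      ((ω : StrongDual ℂ A) (a * a)).re < κ → |((η : StrongDual ℂ A) a).re| < d := by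
  obtain ⟨δ, hδ, h⟩ := hη (d / 2) (half_pos hd)
  set φ := (ω : StrongDual ℂ A)
  have hW : 0 ≤ (φ 1).re := by simpa using hω 1
  set W := (φ 1).re with hWdef
  -- Chosen so that `k W < δ`: then `ω (p * p) < k δ` gives `2 k ω p < 2 k δ`. The `+ 1` covers `W =
  -- 0`.
  set k := δ / (W + 1) with hk
  have hk0 : 0 < k := by positivity
  have hkW : k * W < δ := by
    rw [hk, div_mul_eq_mul_div, div_lt_iff₀ (by positivity)]
    nlinarith
  have hpos : ∀ p : A, IsSelfAdjoint p → 0 ≤ (φ (p * p)).re := fun p hp => by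
    simpa [hp.star_eq] using hω p
  have hsmall : ∀ p : A, IsSelfAdjoint p → (φ (p * p)).re < k * δ → (φ p).re < δ := by
    intro p hp hps
    have h1 := re_apply_le_of_re_apply_mul_self hω hp (k := k)
    rw [← hWdef] at h1
    have : k * (2 * (φ p).re) < k * (2 * δ) := by nlinarith
    linarith [lt_of_mul_lt_mul_left this hk0.le]
  refine ⟨k * δ, by positivity, fun a ha han has => ?_⟩
  obtain ⟨p, n, hp, hn, hp1, hn1, hapn, hsq, hps, hns⟩ := exists_posPart_negPart ha han
  rw [← hsq, map_add, add_re] at has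
  have h1 := h p hp hp1 (hsmall p hps (by linarith [hpos n hns]))
  have h2 := h n hn hn1 (hsmall n hns (by linarith [hpos p hps]))
  rw [hapn, map_sub, sub_re]
  rw [abs_lt] at *
  constructor <;> linarith

/-- If `η` is absolutely continuous, some `b` has the property that `η` is
small where `a ↦ ω (b * a) + ω (a * b)` vanishes. -/
theorem exists_isSelfAdjoint_abs_re_le {ω η : selfAdjointDual A}
    (hω : ∀ b : A, 0 ≤ ((ω : StrongDual ℂ A) (star b * b)).re)
    (hη : η ∈ absolutelyContinuousFunctionals ω) {d : ℝ} (hd : 0 < d) :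
    ∃ b : A, IsSelfAdjoint b ∧ ∀ a : A, IsSelfAdjoint a → ‖a‖ ≤ 1 →
      (jordanTranslate b (ω : StrongDual ℂ A) a).re = 0 →
      |((η : StrongDual ℂ A) a).re| ≤ d := by
  set φ := (ω : StrongDual ℂ A)
  set ψ := (η : StrongDual ℂ A)
  let C : Set A := {a | IsSelfAdjoint a ∧ ‖a‖ ≤ 1 ∧ d ≤ (ψ a).re}
  let q : A → ℝ := fun a => (φ (a * a)).re
  suffices h : ∃ b, IsSelfAdjoint b ∧ ∀ a ∈ C, 0 < (jordanTranslate b φ a).re by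
    obtain ⟨b, hb, h⟩ := h
    refine ⟨b, hb, fun a ha han h0 => abs_le.2 ⟨?_, ?_⟩⟩
    · by_contra! hlt
      have := h (-a) ⟨ha.neg, by rwa [norm_neg], by rw [map_neg, neg_re]; linarith⟩
      rw [map_neg, neg_re] at this
      linarith
    · by_contra! hlt
      exact (h a ⟨ha, han, hlt.le⟩).ne' h0
  rcases C.eq_empty_or_nonempty with hC | hC
  · exact ⟨0, .zero A, by simp [hC]⟩
  obtain ⟨κ, hκ, hκC⟩ := exists_abs_re_lt_of_re_mul_self_lt hω hη hd
  have hqκ : ∀ a ∈ C, κ ≤ q a := fun a ha => by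
    by_contra! hlt
    exact absurd ((le_abs_self _).trans_lt (hκC a ha.1 ha.2.1 hlt)) ha.2.2.not_gt
  have hqW : ∀ a ∈ C, q a ≤ ‖φ‖ := fun a ha => by
    refine (re_le_norm _).trans ((φ.le_opNorm _).trans ?_)
    refine mul_le_of_le_one_right (norm_nonneg _) ((norm_mul_le _ _).trans ?_)
    exact mul_le_one₀ ha.2.1 (norm_nonneg _) ha.2.1
  have hbdd : BddBelow (q '' C) := ⟨κ, by rintro _ ⟨a, ha, rfl⟩; exact hqκ a ha⟩
  set m := sInf (q '' C)
  have hm : 0 < m := hκ.trans_le (le_csInf (hC.image q) (by rintro _ ⟨a, ha, rfl⟩; exact hqκ a ha))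
  have hmq : ∀ a ∈ C, m ≤ q a := fun a ha => csInf_le hbdd ⟨a, ha, rfl⟩
  set W := ‖φ‖
  have hW : 0 ≤ W := norm_nonneg _
  have hmW : 0 < m + W := by linarith
  obtain ⟨_, ⟨b, hb, rfl⟩, hbm⟩ := exists_lt_of_csInf_lt (hC.image q)
    (show m < m + m ^ 2 / (2 * (m + W)) by linarith [show 0 < m ^ 2 / (2 * (m + W)) by positivity])
  refine ⟨b, hb.1, fun a ha => ?_⟩
  by_contra! hB
  -- This `s` minimises `(1 - s) ^ 2 m + s ^ 2 W`, with value `m - s m`. The excess of `q b` over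
  -- `m` is below `s m / 2`, so a nonpositive cross term would push `q` below its infimum.
  set s := m / (m + W) with hs
  have hs0 : 0 < s := by positivity
  have hs1 : s ≤ 1 := (div_le_one hmW).2 (by linarith)
  have hmem : ((1 - s : ℝ) : ℂ) • b + (s : ℂ) • a ∈ C := by
    refine ⟨?_, ?_, ?_⟩
    · simp only [Complex.coe_smul]
      exact ((IsSelfAdjoint.all _).smul hb.1).add ((IsSelfAdjoint.all _).smul ha.1)
    · refine (norm_add_le _ _).trans ?_
      rw [norm_smul, norm_smul, norm_real, norm_real, Real.norm_of_nonneg (by linarith),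
        Real.norm_of_nonneg hs0.le]
      nlinarith [hb.2.1, ha.2.1]
    · rw [map_add, map_smul, map_smul, smul_eq_mul, smul_eq_mul, add_re, re_ofReal_mul,
        re_ofReal_mul]
      nlinarith [hb.2.2, ha.2.2]
  have hexp : q (((1 - s : ℝ) : ℂ) • b + (s : ℂ) • a) =
      (1 - s) ^ 2 * q b + s * (1 - s) * (jordanTranslate b φ a).re + s ^ 2 * q a := by
    simp only [q, jordanTranslate_apply, mul_add, add_mul, smul_mul_assoc, mul_smul_comm, map_add,
      map_smul, smul_eq_mul, add_re, re_ofReal_mul]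
    ring
  have h1 := hmq _ hmem
  rw [hexp] at h1
  have h2 : s * (1 - s) * (jordanTranslate b φ a).re ≤ 0 :=
    mul_nonpos_of_nonneg_of_nonpos (mul_nonneg hs0.le (by linarith)) hB
  have h3 : s ^ 2 * q a ≤ s ^ 2 * W := by gcongr; exact hqW a ha
  have h4 : (1 - s) ^ 2 * q b ≤ (1 - s) ^ 2 * m + m ^ 2 / (2 * (m + W)) := by
    have : (1 - s) ^ 2 ≤ 1 := by nlinarith
    have h5 : 0 < m ^ 2 / (2 * (m + W)) := by positivity
    nlinarith [sq_nonneg (1 - s)]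
  have h6 : s * (m + W) = m := div_mul_cancel₀ _ hmW.ne'
  have h7 : m ^ 2 / (2 * (m + W)) = s * m / 2 := by rw [hs]; field_simp
  have h8 : s ^ 2 * (m + W) = s * m := by rw [sq, mul_assoc, h6]
  have h9 : 0 < s * m := by positivity
  nlinarith

theorem exists_norm_sub_jordanTranslate_le {ω η : selfAdjointDual A}
    (hω : ∀ b : A, 0 ≤ ((ω : StrongDual ℂ A) (star b * b)).re)
    (hη : η ∈ absolutelyContinuousFunctionals ω) {d : ℝ} (hd : 0 < d) :
    ∃ b : A, IsSelfAdjoint b ∧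
      ‖(η : StrongDual ℂ A) - jordanTranslate b (ω : StrongDual ℂ A)‖ ≤ d := by
  obtain ⟨b, hb, h⟩ := exists_isSelfAdjoint_abs_re_le hω hη (half_pos hd)
  have hJ := jordanTranslate_mem_selfAdjointDual ω.2 hb
  -- Working over `ℝ` makes the coefficient real, so it can be absorbed into `b` while keeping it
  -- self-adjoint.
  obtain ⟨c, hc⟩ := exists_norm_sub_sum_smul_le
    (fun _ : Unit => reFunctional (jordanTranslate b (ω : StrongDual ℂ A)))
    (reFunctional (η : StrongDual ℂ A)) (half_pos hd).le fun a ha han => by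
      rw [reFunctional_apply, ← re_apply_realPart η.2, Real.norm_eq_abs]
      refine h _ (realPart a).2 ((realPart.norm_le a).trans han) ?_
      rw [re_apply_realPart hJ]
      exact ha ()
  refine ⟨c () • b, (IsSelfAdjoint.all _).smul hb, ?_⟩
  have h2 := norm_le_of_norm_reFunctional_le
    (φ := (η : StrongDual ℂ A) - jordanTranslate (c () • b) (ω : StrongDual ℂ A)) (d := d / 2) (by
      convert hc using 2
      ext a
      simp [← Complex.coe_smul, mul_add])
  linarith

end SelfAdjointDual

/-! ### Tangent double cones in normed spaces -/

section TangentDoubleCone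

variable {B : Type*} [NormedAddCommGroup B] [NormedSpace ℝ B] {S : Set B} {ξ η : B}

theorem mem_tangentDoubleCone_of_forall_quadratic_mem (ζ : B)
    (h : ∀ t : ℝ, ξ + t • η + t ^ 2 • ζ ∈ S) : η ∈ tangentDoubleCone S ξ := by
  refine ⟨1, one_pos, fun t => ξ + t • η + t ^ 2 • ζ, ?_, fun t _ => h t, by simp, ?_⟩
  · exact ContDiff.contDiffOn (by fun_prop)
  · have h1 := ((hasDerivAt_id (0 : ℝ)).smul_const η).const_add ξ
    have h2 := (hasDerivAt_pow 2 (0 : ℝ)).smul_const ζ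
    simpa using! h1.add h2

theorem exists_mem_norm_sub_le_of_mem_tangentDoubleCone (h : η ∈ tangentDoubleCone S ξ) {ε : ℝ}
    (hε : 0 < ε) :
    ∃ t : ℝ, 0 < t ∧ ∀ u : ℝ, |u| = t → ∃ ζ ∈ S, ‖ζ - (ξ + u • η)‖ ≤ ε * t := by
  obtain ⟨r, hr, γ, -, hγ, hγ0, hder⟩ := h
  have hlo := (hasDerivAt_iff_isLittleO_nhds_zero.1 hder).def hε
  obtain ⟨s, hs, hsb⟩ := Metric.eventually_nhds_iff.1 hlo
  have hm : 0 < min r s := lt_min hr hs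
  refine ⟨min r s / 2, by positivity, fun u hu => ?_⟩
  refine ⟨γ u, hγ u (abs_lt.1 (by linarith [min_le_left r s])), ?_⟩
  have h1 := hsb (y := u) (by rw [Real.dist_eq, sub_zero]; linarith [min_le_right r s])
  rwa [zero_add, hγ0, Real.norm_eq_abs, hu, sub_sub] at h1

end TangentDoubleCone

/-! ### The two inclusions -/

section Main

variable {A : Type*} [CStarAlgebra A] {X : Type*} [NormedAddCommGroup X] [NormedSpace ℂ X]

theorem jordanTranslate_mem_tangentDoubleCone [CompleteSpace X] (e : StrongDual ℂ X ≃ₗᵢ[ℂ] A)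
    (ω : selfAdjointDual A) (hω : ω ∈ normalPositiveFunctionals e) {b : A} (hb : IsSelfAdjoint b) :
    (⟨jordanTranslate b ω, jordanTranslate_mem_selfAdjointDual ω.2 hb⟩ : selfAdjointDual A) ∈
      tangentDoubleCone (normalPositiveFunctionals e) ω := by
  refine mem_tangentDoubleCone_of_forall_quadratic_mem
    (⟨conjTranslate b ω, conjTranslate_mem_selfAdjointDual ω.2 hb⟩ : selfAdjointDual A)
    fun t => ⟨fun x => ?_, ?_⟩
  · have h := hω.1 (x * (1 + (t : ℂ) • b))
    have h1 : (ω : StrongDual ℂ A) (star (x * (1 + (t : ℂ) • b)) * (x * (1 + (t : ℂ) • b))) =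
        (ω : StrongDual ℂ A) (star x * x) + (t : ℂ) * jordanTranslate b ω (star x * x) +
          ((t ^ 2 : ℝ) : ℂ) * conjTranslate b ω (star x * x) := by
      simp only [star_mul, star_add, star_smul, hb.star_eq, Complex.star_def,
        Complex.conj_ofReal, mul_add, add_mul, mul_one, smul_mul_assoc, mul_smul_comm,
        map_add, map_smul, jordanTranslate_apply, conjTranslate_apply, smul_eq_mul, mul_assoc]
      push_cast
      ring
    rw [h1] at h
    exact h
  · exact (hω.2.add ((hω.2.jordanTranslate hb).smul (t : ℂ))).add
      ((hω.2.conjTranslate hb).smul ((t ^ 2 : ℝ) : ℂ))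

theorem abs_re_apply_sub_le (η ζ : selfAdjointDual A) {a : A} (ha : ‖a‖ ≤ 1) :
    |((η : StrongDual ℂ A) a).re - ((ζ : StrongDual ℂ A) a).re| ≤
      ‖(η : StrongDual ℂ A) - (ζ : StrongDual ℂ A)‖ := by
  have h := ((η : StrongDual ℂ A) - (ζ : StrongDual ℂ A)).le_opNorm a
  have h2 := Complex.abs_re_le_norm (((η : StrongDual ℂ A) - (ζ : StrongDual ℂ A)) a)
  exact h2.trans (h.trans (mul_le_of_le_one_right (norm_nonneg _) ha))

theorem dist_selfAdjointDual (η ζ : selfAdjointDual A) :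
    dist η ζ = ‖(η : StrongDual ℂ A) - (ζ : StrongDual ℂ A)‖ :=
  dist_eq_norm (η : StrongDual ℂ A) ζ

/-- Positivity near `ω + t η` and near `ω - t η`, at one small `t`, bounds `η a` from both sides;
this is where a two-sided curve matters. -/
theorem tangentDoubleCone_subset_absolutelyContinuousFunctionals (e : StrongDual ℂ X ≃ₗᵢ[ℂ] A)
    (ω : selfAdjointDual A) :
    tangentDoubleCone (normalPositiveFunctionals e) ω ⊆ absolutelyContinuousFunctionals ω := by
  intro η hη ε hε
  obtain ⟨t, ht0, ht⟩ := exists_mem_norm_sub_le_of_mem_tangentDoubleCone hη (half_pos hε)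
  have key : ∀ u : ℝ, |u| = t → ∀ a : A, (∃ b : A, a = star b * b) → ‖a‖ ≤ 1 →
      0 ≤ ((ω : StrongDual ℂ A) a).re + u * ((η : StrongDual ℂ A) a).re + ε / 2 * t := by
    rintro u hu a ⟨b, rfl⟩ ha
    obtain ⟨ζ, hζ, h1⟩ := ht u hu
    have h2 := hζ.1 b
    have h3 := (abs_re_apply_sub_le ζ (ω + u • η) ha).trans h1
    have h4 : (((ω + u • η : selfAdjointDual A) : StrongDual ℂ A) (star b * b)).re =
        ((ω : StrongDual ℂ A) (star b * b)).re + u * ((η : StrongDual ℂ A) (star b * b)).re := by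
      simp
    rw [h4] at h3
    linarith [(abs_le.1 h3).2]
  refine ⟨ε / 2 * t, by positivity, fun a ha han hωa => ?_⟩
  have h1 := key t (abs_of_pos ht0) a ha han
  have h2 := key (-t) (by rw [abs_neg, abs_of_pos ht0]) a ha han
  rw [abs_lt]
  constructor <;> refine lt_of_mul_lt_mul_left ?_ ht0.le <;> linarith

theorem isClosed_absolutelyContinuousFunctionals (ω : selfAdjointDual A) :
    IsClosed (absolutelyContinuousFunctionals ω) := by
  refine isClosed_of_closure_subset fun η hη ε hε => ?_
  obtain ⟨ζ, hζ, hd⟩ := Metric.mem_closure_iff.1 hη (ε / 2) (half_pos hε)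
  obtain ⟨δ, hδ, h⟩ := hζ (ε / 2) (half_pos hε)
  refine ⟨δ, hδ, fun a ha han hωa => ?_⟩
  have h1 := h a ha han hωa
  have h2 := abs_re_apply_sub_le η ζ han
  rw [dist_selfAdjointDual] at hd
  rw [abs_lt] at *
  rw [abs_le] at h2
  constructor <;> linarith

end Main

theorem mainTheorem3 {A : Type*} [CStarAlgebra A]
    {X : Type*} [NormedAddCommGroup X] [NormedSpace ℂ X] [CompleteSpace X]
    (e : StrongDual ℂ X ≃ₗᵢ[ℂ] A)
    (ω : selfAdjointDual A) (hω : ω ∈ normalPositiveFunctionals e) :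
    closure (tangentDoubleCone (normalPositiveFunctionals e) ω) =
      absolutelyContinuousFunctionals ω := by
  refine subset_antisymm (closure_minimal
    (tangentDoubleCone_subset_absolutelyContinuousFunctionals e ω)
    (isClosed_absolutelyContinuousFunctionals ω)) fun η hη => ?_
  refine Metric.mem_closure_iff.2 fun ε hε => ?_
  obtain ⟨b, hb, h⟩ := exists_norm_sub_jordanTranslate_le hω.1 hη (half_pos hε)
  refine ⟨_, jordanTranslate_mem_tangentDoubleCone e ω hω hb, ?_⟩
  rw [dist_selfAdjointDual]
  exact lt_of_le_of_lt h (half_lt_self hε)
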